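/- Consider Two-Stage Resource Allocation. An instance consists of a bipartite graph with a finite set $E^1\subseteq I\times H$ of offline edges and a finite set $E^2\subseteq I\times J$ of online edges ($J$ finite; $E^2_j$ denotes the edges of $E^2$ incident to $j\in J$), finite sets $\mathcal K_1$ and $\mathcal K_2\neq\emptyset$ of integral and non-integral resources, budgets $B_k>0$ for $k\in\mathcal K_1\cup\mathcal K_2$, with $B_k\in\mathbb Z$ for $k\in\mathcal K_1$, rewards $w_e>0$ and consumptions $a_{e,k}\in[0,1]$, with $a_{e,k}\in\{0,1\}$ for $k\in\mathcal K_1$, a horizon $T$, and probabilities $p_{jt}\ge 0$ with $\sum_{j\in J}p_{jt}=1$ for each $t\in[T]$. In Phase I one selects a multiset of edges of $E^1$. In Phase II, in each round $t=1,\dots,T$, independently, a vertex $j\in J$ arrives with probability $p_{jt}$, and one irrevocably selects at most one edge of $E^2_j$. The total consumption of each resource $k$ over both phases must not exceed $B_k$; the profit is the total reward of the selected edges, counted with multiplicity. Let $\mathbb E[\mathrm{OPT}]$ be the expectation, over the arrival sequence, of the largest profit attainable when the whole arrival sequence is known in advance. The benchmark LP is $$\max \sum_{e\in E^1}w_ex_e+\sum_{e\in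 E^2,\,t\in[T]}w_ey_{e,t}$$ subject to $\sum_{e\in E^2_j}y_{e,t}\le p_{jt}$ for all $j\in J$, $t\in[T]$; $\sum_{e\in E^1}x_ea_{e,k}+\sum_{e\in E^2,\,t\in[T]}y_{e,t}a_{e,k}\le B_k$ for all $k$; $x_e\ge 0$ and $0\le y_{e,t}\le 1$. Given an optimal solution $(x^*,y^*)$ of this LP and $\eta,\alpha\in(0,1]$, the algorithm $\mathsf{SAMP}(\eta,\alpha)$ works as follows. Phase I: independently for each $e\in E^1$, sample $\mathrm{RD}(\eta x_e^*)$ copies of $e$, where $\mathrm{RD}(v)$ equals $\lceil v\rceil$ with probability $v-\lfloor v\rfloor$ and $\lfloor v\rfloor$ otherwise. Then simultaneously, for every $e$ such that $a_{e,k}>0$ for some resource $k$ whose budget is exceeded by the total consumption of the sampled multiset, remove all copies of $e$. Phase II: when $j$ arrives in round $t$, sample at most one edge of $E^2_j$, each $e\in E_j^2$ with probability $\alpha y^*_{e,t}/p_{jt}$, independently of everything before, and select the sampled edge if and only if adding it to what has been selected so far exceeds no budget. Theorem. Let $\ell_1,\ell_2\ge 0$ be integers with $\ell=\ell_1+\ell_2\ge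 1$ such that every edge $e$ has $a_{e,k}>0$ for at most $\ell_1$ resources $k\in\mathcal K_1$ and at most $\ell_2$ resources $k\in\mathcal K_2$. Let $B=\min_{k\in\mathcal K_2}B_k\neq 2$ and $$\varepsilon=2\max\left(\frac1{B-2},\ \ell_2\exp\left(-\frac B{12}+\frac16\right)\right).$$ Then, for every optimal solution $(x^*,y^*)$ of the benchmark LP, $\mathsf{SAMP}(\eta,\alpha)$ with $\eta=\alpha=\frac1{2\ell}$ almost surely satisfies all budget constraints and selects in each round only an edge incident to the arriving vertex, and its expected profit is at least $\frac{1-\varepsilon}{4\ell}$ times the optimal value of the benchmark LP; moreover, its expected profit is at least $\frac{1-\varepsilon}{4\ell}\,\mathbb E[\mathrm{OPT}]$. -/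

import Mathlib

noncomputable section

/-- The probability mass function with given nonnegative real weights summing to one. -/
def pmfOfReal {β : Type*} [Fintype β] (f : β → ℝ) (h0 : ∀ b, 0 ≤ f b) (h1 : ∑ b, f b = 1) :
    PMF β :=
  PMF.ofFintype (fun b => ENNReal.ofReal (f b)) (by
    rw [← ENNReal.ofReal_sum_of_nonneg (fun b _ => h0 b), h1, ENNReal.ofReal_one])

open scoped Classical in
/-- The joint law of finitely many independent random variables with laws `q i`. -/
def pmfPi {ι β : Type*} [Fintype ι] [Fintype β] (q : ι → PMF β) : PMF (ι → β) :=
  PMF.ofFintype (fun g => ∏ i, q i (g i)) (by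
    have h := (Fintype.prod_sum (fun (i : ι) (b : β) => q i b)).symm
    rw [h]
    refine Finset.prod_eq_one fun i _ => ?_
    rw [← tsum_fintype (L := SummationFilter.unconditional β)]
    exact (q i).tsum_coe)

/-- An instance of Two-Stage Resource Allocation.  `I` are the offline types matched in both
phases, `H` the types of the offline phase, `J` the types of vertices arriving online; `K₁` indexes
the integral resources and `K₂` the non-integral ones. -/
structure TSRA (I H J K₁ K₂ : Type*) [Fintype J] where
  /-- Edges of the offline phase. -/
  E₁ : Finset (I × H)
  /-- Edges of the online phase. -/
  E₂ : Finset (I × J)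
  /-- Budget of each resource. -/
  budget : K₁ ⊕ K₂ → ℝ
  budget_pos : ∀ k, 0 < budget k
  budget_integral : ∀ k : K₁, ∃ n : ℕ, budget (Sum.inl k) = n
  /-- Reward of each edge. -/
  w : E₁ ⊕ E₂ → ℝ
  w_pos : ∀ e, 0 < w e
  /-- `a e k` is the amount of resource `k` consumed by one copy of the edge `e`. -/
  a : E₁ ⊕ E₂ → K₁ ⊕ K₂ → ℝ
  a_mem : ∀ e k, a e k ∈ Set.Icc (0 : ℝ) 1
  a_integral : ∀ e (k : K₁), a e (Sum.inl k) = 0 ∨ a e (Sum.inl k) = 1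
  /-- Time horizon. -/
  T : ℕ
  /-- `p j t` is the probability that a vertex of type `j` arrives in round `t`. -/
  p : J → Fin T → ℝ
  p_nonneg : ∀ j t, 0 ≤ p j t
  p_sum : ∀ t, ∑ j, p j t = 1

namespace TSRA

variable {I H J K₁ K₂ : Type*} [Fintype J]

/-- Every edge requests at most `ℓ₁` integral and at most `ℓ₂` non-integral resources. -/
def IsSparse [Fintype K₁] [Fintype K₂] (P : TSRA I H J K₁ K₂) (ℓ₁ ℓ₂ : ℕ) : Prop :=
  ∀ e, (Finset.univ.filter fun k : K₁ => 0 < P.a e (Sum.inl k)).card ≤ ℓ₁ ∧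
    (Finset.univ.filter fun k : K₂ => 0 < P.a e (Sum.inr k)).card ≤ ℓ₂

/-! ### Integral allocations and the offline optimum -/

/-- An integral allocation: how many copies of each offline edge are taken, and which online edge
(if any) is taken in each round. -/
structure Allocation (P : TSRA I H J K₁ K₂) where
  copies : P.E₁ → ℕ
  pick : Fin P.T → Option P.E₂

/-- Total reward of an allocation. -/
def Allocation.profit {P : TSRA I H J K₁ K₂} (A : P.Allocation) : ℝ :=
  ∑ e, P.w (Sum.inl e) * A.copies e + ∑ t, (A.pick t).elim 0 fun e => P.w (Sum.inr e)

/-- Total consumption of resource `k` by an allocation. -/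
def Allocation.cost {P : TSRA I H J K₁ K₂} (A : P.Allocation) (k : K₁ ⊕ K₂) : ℝ :=
  ∑ e, A.copies e * P.a (Sum.inl e) k + ∑ t, (A.pick t).elim 0 fun e => P.a (Sum.inr e) k

/-- An allocation is admissible for the arrival sequence `σ` if the edge taken in a round is
incident to the vertex arriving in that round, and no budget is exceeded. -/
structure Allocation.IsAdmissible {P : TSRA I H J K₁ K₂} (A : P.Allocation) (σ : Fin P.T → J) :
    Prop where
  incident : ∀ t e, A.pick t = some e → e.1.2 = σ t
  within_budget : ∀ k, A.cost k ≤ P.budget k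

/-- The largest profit of an allocation that is admissible for `σ`. -/
def offlineOpt (P : TSRA I H J K₁ K₂) (σ : Fin P.T → J) : ℝ :=
  sSup {v | ∃ A : P.Allocation, A.IsAdmissible σ ∧ v = A.profit}

/-- The expectation of the offline optimum over the arrival sequence, whose entries are
independent, the one of round `t` being `j` with probability `p j t`. -/
def expectedOpt (P : TSRA I H J K₁ K₂) : ℝ :=
  ∑ σ : Fin P.T → J, (∏ t, P.p (σ t) t) * P.offlineOpt σ

/-! ### The benchmark linear program -/

open scoped Classical in
/-- Feasibility in the benchmark LP. -/
structure IsFeasible (P : TSRA I H J K₁ K₂) (x : P.E₁ → ℝ) (y : P.E₂ → Fin P.T → ℝ) : Prop where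
  arrival : ∀ j t, ∑ e with e.1.2 = j, y e t ≤ P.p j t
  resource : ∀ k, ∑ e, x e * P.a (Sum.inl e) k + ∑ e, ∑ t, y e t * P.a (Sum.inr e) k ≤ P.budget k
  x_nonneg : ∀ e, 0 ≤ x e
  y_nonneg : ∀ e t, 0 ≤ y e t
  y_le_one : ∀ e t, y e t ≤ 1

/-- Objective of the benchmark LP. -/
def lpValue (P : TSRA I H J K₁ K₂) (x : P.E₁ → ℝ) (y : P.E₂ → Fin P.T → ℝ) : ℝ :=
  ∑ e, P.w (Sum.inl e) * x e + ∑ e, ∑ t, P.w (Sum.inr e) * y e t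

/-- Optimal solutions of the benchmark LP. -/
structure IsOptimal (P : TSRA I H J K₁ K₂) (x : P.E₁ → ℝ) (y : P.E₂ → Fin P.T → ℝ) : Prop where
  feasible : P.IsFeasible x y
  maximal : ∀ x' y', P.IsFeasible x' y' → P.lpValue x' y' ≤ P.lpValue x y

/-! ### The algorithm `SAMP` -/

/-- All randomness of a run of `SAMP`: for each offline edge a coin that decides whether its
scaled LP value is rounded up, and for each round the type of the arriving vertex together with
the edge sampled for it, if any. -/
abbrev Coins (P : TSRA I H J K₁ K₂) : Type _ :=
  (P.E₁ → Bool) × (Fin P.T → J × Option P.E₂)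

/-- The rounding of `v ≥ 0` up or down; with `roundCoin v` it is the unbiased randomized
rounding of `v` to one of the two adjacent integers. -/
def rounded (v : ℝ) (up : Bool) : ℕ := if up then ⌈v⌉₊ else ⌊v⌋₊

/-- The coin that says "up" with probability `v - ⌊v⌋`. -/
def roundCoin (v : ℝ) : PMF Bool :=
  pmfOfReal (fun up => if up then Int.fract v else 1 - Int.fract v)
    (by
      rintro (_ | _)
      · simpa using (Int.fract_lt_one v).le
      · simp)
    (by simp)

section law

variable (P : TSRA I H J K₁ K₂)

/-- The law of the type of the vertex arriving in round `t`. -/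
def arrivalLaw (t : Fin P.T) : PMF J :=
  pmfOfReal (fun j => P.p j t) (fun j => P.p_nonneg j t) (P.p_sum t)

open scoped Classical in
/-- The probability of sampling the edge `e` when `j` arrives in round `t`. -/
def sampleProb (α : ℝ) (y : P.E₂ → Fin P.T → ℝ) (t : Fin P.T) (j : J) (e : P.E₂) : ℝ :=
  if e.1.2 = j then α * y e t / P.p j t else 0

variable {P} {x : P.E₁ → ℝ} {y : P.E₂ → Fin P.T → ℝ}

theorem sampleProb_nonneg (h : P.IsFeasible x y) (α : Set.Ioc (0 : ℝ) 1) (t : Fin P.T) (j : J)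
    (e : P.E₂) : 0 ≤ P.sampleProb α y t j e := by
  unfold sampleProb
  split_ifs
  · exact div_nonneg (mul_nonneg α.2.1.le (h.y_nonneg e t)) (P.p_nonneg j t)
  · exact le_rfl

theorem sum_sampleProb_le_one (h : P.IsFeasible x y) (α : Set.Ioc (0 : ℝ) 1) (t : Fin P.T)
    (j : J) : ∑ e, P.sampleProb α y t j e ≤ 1 := by
  classical
  unfold sampleProb
  rw [← Finset.sum_filter, ← Finset.sum_div, ← Finset.mul_sum]
  have h1 : ∑ e with e.1.2 = j, y e t ≤ P.p j t := by convert h.arrival j t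
  have h0 : 0 ≤ ∑ e with e.1.2 = j, y e t := Finset.sum_nonneg fun e _ => h.y_nonneg e t
  exact div_le_one_of_le₀ ((mul_le_of_le_one_left h0 α.2.2).trans h1) (P.p_nonneg j t)

/-- The law of the edge sampled when `j` arrives in round `t`; with the remaining probability no
edge is sampled. -/
def sampleLaw (h : P.IsFeasible x y) (α : Set.Ioc (0 : ℝ) 1) (t : Fin P.T) (j : J) :
    PMF (Option P.E₂) :=
  pmfOfReal
    (fun o => o.elim (1 - ∑ e, P.sampleProb α y t j e) (P.sampleProb α y t j))
    (by
      rintro (_ | e)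
      · exact sub_nonneg.2 (sum_sampleProb_le_one h α t j)
      · exact sampleProb_nonneg h α t j e)
    (by rw [Fintype.sum_option]; simp)

/-- The law of one round: a vertex arrives, then an edge is sampled for it. -/
def roundLaw (h : P.IsFeasible x y) (α : Set.Ioc (0 : ℝ) 1) (t : Fin P.T) :
    PMF (J × Option P.E₂) :=
  (P.arrivalLaw t).bind fun j => (sampleLaw h α t j).map fun o => (j, o)

/-- The law of all coins of `SAMP(η, α)`: rounding coins and rounds are all independent. -/
def coinLaw (h : P.IsFeasible x y) (η α : Set.Ioc (0 : ℝ) 1) : PMF P.Coins :=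
  (pmfPi fun e => roundCoin (η * x e)).bind fun b =>
    (pmfPi fun t => roundLaw h α t).map fun r => (b, r)

end law

section run

variable (P : TSRA I H J K₁ K₂)

/-- The number of copies of `e` sampled in Phase I. -/
def sampledCopies (η : ℝ) (x : P.E₁ → ℝ) (ω : P.Coins) (e : P.E₁) : ℕ :=
  rounded (η * x e) (ω.1 e)

/-- The sampled multiset overruns the budget of resource `k`. -/
def Overrun (η : ℝ) (x : P.E₁ → ℝ) (ω : P.Coins) (k : K₁ ⊕ K₂) : Prop :=
  P.budget k < ∑ e, P.sampledCopies η x ω e * P.a (Sum.inl e) k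

open scoped Classical in
/-- The number of copies of `e` kept at the end of Phase I: all copies are removed if `e` requests
a resource with a budget overrun. -/
def keptCopies (η : ℝ) (x : P.E₁ → ℝ) (ω : P.Coins) (e : P.E₁) : ℕ :=
  if ∃ k, 0 < P.a (Sum.inl e) k ∧ P.Overrun η x ω k then 0 else P.sampledCopies η x ω e

open scoped Classical in
/-- The sampled edge is selected iff adding it to the consumption `u` breaks no budget. -/
def accept (u : K₁ ⊕ K₂ → ℝ) (o : Option P.E₂) : Option P.E₂ :=
  o.bind fun e => if ∀ k, u k + P.a (Sum.inr e) k ≤ P.budget k then some e else none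

/-- The consumption of each resource by Phase I and the first `n` rounds of Phase II. -/
def consumption (η : ℝ) (x : P.E₁ → ℝ) (ω : P.Coins) : ℕ → K₁ ⊕ K₂ → ℝ
  | 0, k => ∑ e, P.keptCopies η x ω e * P.a (Sum.inl e) k
  | n + 1, k => consumption η x ω n k +
      if h : n < P.T then
        (P.accept (consumption η x ω n) (ω.2 ⟨n, h⟩).2).elim 0 fun e => P.a (Sum.inr e) k
      else 0

/-- The allocation produced by `SAMP` from its coins. -/
def samp (η : ℝ) (x : P.E₁ → ℝ) (ω : P.Coins) : P.Allocation where
  copies := P.keptCopies η x ω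
  pick t := P.accept (P.consumption η x ω t) (ω.2 t).2

/-- The arrival sequence met in a run. -/
def arrivals (ω : P.Coins) (t : Fin P.T) : J := (ω.2 t).1

open scoped Classical in
/-- The expected profit of `SAMP(η, α)` guided by the feasible solution `(x, y)`. -/
def expectedProfit {x : P.E₁ → ℝ} {y : P.E₂ → Fin P.T → ℝ} (h : P.IsFeasible x y)
    (η α : Set.Ioc (0 : ℝ) 1) : ℝ :=
  ∑ ω : P.Coins, (coinLaw h η α ω).toReal * (P.samp η x ω).profit

end run

end TSRA

/-- The scaling factor `1 / (2 ℓ)`, as an element of `(0, 1]`. -/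
def halfInv (ℓ : ℕ) (h : 1 ≤ ℓ) : Set.Ioc (0 : ℝ) 1 :=
  ⟨1 / (2 * ℓ), by
    have h' : (1 : ℝ) ≤ ℓ := by exact_mod_cast h
    refine ⟨by positivity, ?_⟩
    rw [div_le_one (by positivity)]
    linarith⟩

end

noncomputable section

/-! The argument needs only Markov's inequality, pairwise independence and a union bound over
requested resources; no concentration inequality enters. Write `θ = 1/(2ℓ)`. An edge is sampled in
expectation `θ` times as often as in the LP, so it suffices that each requested resource destroys at
most a fraction `θ(1+ε)` of these samples. The union bound over at most `ℓ` resources then leaves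
the factor `θ(1 - ℓθ(1+ε)) = (1-ε)/(4ℓ)`.

If resource `k` blocks an edge, the other samples must already consume about `P.threshold k`: the
full budget for an integral resource, the budget minus one otherwise. Their expected consumption is
at most `θ` times the budget by LP feasibility, and they are independent of the edge's own sample.
Bounding the blocking indicator by consumption over threshold and factoring the expectation gives
the fraction `θ(1+ε)`, because the budget is at most `(1+ε)` times the threshold. This is
`expect_sampledCopies_overrun_le` in Phase I and `expect_sampled_exceeded_le` in Phase II. The
comparison of budget and threshold is `budget_le_threshold`, the only place where the precise shape
of `ε` matters; for `ε ≥ 1` the claim is trivial.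

The comparison with the offline optimum follows because averaging admissible allocations over the
arrival sequence yields a feasible LP solution. -/

/-- The expectation of a real function under a probability mass function on a finite type. -/
def PMF.expect {Ω : Type*} [Fintype Ω] (μ : PMF Ω) (f : Ω → ℝ) : ℝ :=
  ∑ ω, (μ ω).toReal * f ω

/-! ### Expectations on finite probability spaces -/

namespace PMF

section expect

variable {Ω : Type*} [Fintype Ω] (μ : PMF Ω)

theorem sum_toReal : ∑ ω, (μ ω).toReal = 1 := by
  rw [← ENNReal.toReal_sum fun ω _ => μ.apply_ne_top ω,
    ← tsum_fintype (L := SummationFilter.unconditional Ω), μ.tsum_coe, ENNReal.toReal_one]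

theorem expect_const (c : ℝ) : μ.expect (fun _ => c) = c := by
  rw [expect, ← Finset.sum_mul, sum_toReal, one_mul]

theorem expect_mono {f g : Ω → ℝ} (h : ∀ ω, f ω ≤ g ω) : μ.expect f ≤ μ.expect g :=
  Finset.sum_le_sum fun ω _ => mul_le_mul_of_nonneg_left (h ω) ENNReal.toReal_nonneg

theorem expect_add (f g : Ω → ℝ) : μ.expect (fun ω => f ω + g ω) = μ.expect f + μ.expect g := by
  simp only [expect, mul_add, Finset.sum_add_distrib]

theorem expect_sub (f g : Ω → ℝ) : μ.expect (fun ω => f ω - g ω) = μ.expect f - μ.expect g := by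
  simp only [expect, mul_sub, Finset.sum_sub_distrib]

theorem expect_const_mul (c : ℝ) (f : Ω → ℝ) :
    μ.expect (fun ω => c * f ω) = c * μ.expect f := by
  simp only [expect, Finset.mul_sum]
  exact Finset.sum_congr rfl fun ω _ => by ring

theorem expect_mul_const (c : ℝ) (f : Ω → ℝ) :
    μ.expect (fun ω => f ω * c) = μ.expect f * c := by
  simp only [expect, Finset.sum_mul]
  exact Finset.sum_congr rfl fun ω _ => by ring

theorem expect_sum {ι : Type*} (s : Finset ι) (f : ι → Ω → ℝ) :
    μ.expect (fun ω => ∑ i ∈ s, f i ω) = ∑ i ∈ s, μ.expect (f i) := by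
  simp only [expect, Finset.mul_sum]
  exact Finset.sum_comm

theorem expect_bind_pair {Ω' : Type*} [Fintype Ω'] (ν : Ω → PMF Ω') (f : Ω × Ω' → ℝ) :
    (μ.bind fun b => (ν b).map fun o => (b, o)).expect f =
      μ.expect fun b => (ν b).expect fun o => f (b, o) := by
  classical
  have key : ∀ b o, (μ.bind fun b => (ν b).map fun o => (b, o)) (b, o) = μ b * ν b o := by
    intro b o
    rw [bind_apply, tsum_eq_single b]
    · rw [map_apply, tsum_eq_single o]
      · simp
      · intro o' h
        simp [Ne.symm h]
    · intro b' h
      rw [map_apply]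
      simp [Ne.symm h]
  simp only [expect, Fintype.sum_prod_type, key, ENNReal.toReal_mul, Finset.mul_sum]
  exact Finset.sum_congr rfl fun b _ => Finset.sum_congr rfl fun o _ => by ring

theorem expect_bind_map_mul {Ω' : Type*} [Fintype Ω'] (ν : PMF Ω') (f : Ω → ℝ) (g : Ω' → ℝ) :
    (μ.bind fun b => ν.map fun o => (b, o)).expect (fun ω => f ω.1 * g ω.2) =
      μ.expect f * ν.expect g := by
  rw [expect_bind_pair μ (fun _ => ν)]
  simp only [expect_const_mul, expect_mul_const]

end expect

end PMF

open PMF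

theorem expect_pmfOfReal {β : Type*} [Fintype β] (f : β → ℝ) (h0 : ∀ b, 0 ≤ f b)
    (h1 : ∑ b, f b = 1) (g : β → ℝ) : (pmfOfReal f h0 h1).expect g = ∑ b, f b * g b := by
  simp [expect, pmfOfReal, ENNReal.toReal_ofReal, h0]

/-! ### Factorisation of expectations under product laws -/

section product

variable {ι β : Type*} [Fintype ι] [Fintype β]

theorem pmfPi_apply_toReal (q : ι → PMF β) (r : ι → β) :
    (pmfPi q r).toReal = ∏ i, (q i (r i)).toReal := by
  simp [pmfPi, ENNReal.toReal_prod]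

variable [DecidableEq ι]

/-- Both test functions are absorbed into a family of factors equal to 1 at all other coordinates;
the sum then factorises over coordinates, and the remaining ones sum to 1. -/
theorem sum_prod_mul_pair (q : ι → β → ℝ) (hq : ∀ i, ∑ b, q i b = 1) {i j : ι} (hij : i ≠ j)
    (f g : β → ℝ) :
    ∑ r : ι → β, (∏ k, q k (r k)) * (f (r i) * g (r j)) =
      (∑ b, q i b * f b) * ∑ b, q j b * g b := by
  set h : ι → β → ℝ := fun k b => if k = i then f b else if k = j then g b else 1 with hh
  have h1 : ∀ r : ι → β, f (r i) * g (r j) = ∏ k, h k (r k) := by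
    intro r
    rw [Fintype.prod_eq_mul i j hij]
    · simp [hh, hij.symm]
    · rintro k ⟨hi, hj⟩
      simp [hh, hi, hj]
  simp only [h1, ← Finset.prod_mul_distrib]
  rw [← Fintype.prod_sum fun k b => q k b * h k b, Fintype.prod_eq_mul i j hij]
  · simp [hh, hij.symm]
  · rintro k ⟨hi, hj⟩
    simp [hh, hi, hj, hq]

theorem sum_prod_mul_single (q : ι → β → ℝ) (hq : ∀ i, ∑ b, q i b = 1) (i : ι) (f : β → ℝ) :
    ∑ r : ι → β, (∏ k, q k (r k)) * f (r i) = ∑ b, q i b * f b := by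
  set h : ι → β → ℝ := fun k b => if k = i then f b else 1 with hh
  have h1 : ∀ r : ι → β, f (r i) = ∏ k, h k (r k) := by
    intro r
    rw [Fintype.prod_eq_single i]
    · simp [hh]
    · intro k hk
      simp [hh, hk]
  simp only [h1, ← Finset.prod_mul_distrib]
  rw [← Fintype.prod_sum fun k b => q k b * h k b, Fintype.prod_eq_single i]
  · simp [hh]
  · intro k hk
    simp [hh, hk, hq]

theorem expect_pmfPi_pair (q : ι → PMF β) {i j : ι} (hij : i ≠ j) (f g : β → ℝ) :
    (pmfPi q).expect (fun r => f (r i) * g (r j)) = (q i).expect f * (q j).expect g := by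
  simp only [expect, pmfPi_apply_toReal]
  exact sum_prod_mul_pair (fun i b => (q i b).toReal) (fun i => (q i).sum_toReal) hij f g

theorem expect_pmfPi_single (q : ι → PMF β) (i : ι) (f : β → ℝ) :
    (pmfPi q).expect (fun r => f (r i)) = (q i).expect f := by
  simp only [expect, pmfPi_apply_toReal]
  exact sum_prod_mul_single (fun i b => (q i b).toReal) (fun i => (q i).sum_toReal) i f

end product

namespace TSRA

variable {I H J K₁ K₂ : Type*} [Fintype J] (P : TSRA I H J K₁ K₂)

theorem a_nonneg (e k) : 0 ≤ P.a e k := (P.a_mem e k).1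

theorem a_le_one (e k) : P.a e k ≤ 1 := (P.a_mem e k).2

variable {P} in
theorem Allocation.profit_nonneg (A : P.Allocation) : 0 ≤ A.profit := by
  refine add_nonneg (Finset.sum_nonneg fun e _ => mul_nonneg (P.w_pos _).le (Nat.cast_nonneg _))
    (Finset.sum_nonneg fun t _ => ?_)
  cases A.pick t
  · exact le_rfl
  · exact (P.w_pos _).le

/-! ### Pathwise bounds: budgets and what a violation implies -/

section pathwise

variable (η : ℝ) (x : P.E₁ → ℝ) (ω : P.Coins)

theorem keptCopies_le_sampledCopies (e) : P.keptCopies η x ω e ≤ P.sampledCopies η x ω e := by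
  unfold keptCopies
  split_ifs
  · exact Nat.zero_le _
  · exact le_rfl

/-- An overrun resource loses every edge requesting it, so nothing of it is consumed; for any other
resource, removals only lower the sampled consumption. -/
theorem kept_cost_le_budget (k) :
    ∑ e, P.keptCopies η x ω e * P.a (Sum.inl e) k ≤ P.budget k := by
  by_cases h : P.Overrun η x ω k
  · refine le_trans (le_of_eq (Finset.sum_eq_zero fun e _ => ?_)) (P.budget_pos k).le
    rcases (P.a_nonneg (Sum.inl e) k).eq_or_lt with ha | ha
    · simp [← ha]
    · rw [keptCopies, if_pos ⟨k, ha, h⟩]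
      simp
  · refine le_trans (Finset.sum_le_sum fun e _ => ?_) (not_lt.1 h)
    exact mul_le_mul_of_nonneg_right
      (Nat.cast_le.2 (P.keptCopies_le_sampledCopies η x ω e)) (P.a_nonneg _ _)

theorem accept_eq_some {u : K₁ ⊕ K₂ → ℝ} {o : Option P.E₂} {e : P.E₂}
    (h : P.accept u o = some e) : o = some e ∧ ∀ k, u k + P.a (Sum.inr e) k ≤ P.budget k := by
  cases o with
  | none => simp [accept] at h
  | some e' =>
    simp only [accept, Option.bind_some] at h
    split_ifs at h with h'
    obtain rfl := Option.some.inj h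
    exact ⟨rfl, h'⟩

theorem consumption_le_budget (n : ℕ) (k) : P.consumption η x ω n k ≤ P.budget k := by
  induction n with
  | zero => exact P.kept_cost_le_budget η x ω k
  | succ n ih =>
    rw [consumption]
    split_ifs with h
    · cases ho : P.accept (P.consumption η x ω n) (ω.2 ⟨n, h⟩).2 with
      | none => simpa using ih
      | some e => exact (P.accept_eq_some ho).2 k
    · simpa using ih

theorem consumption_eq (n : ℕ) (k) : P.consumption η x ω n k =
    ∑ e, P.keptCopies η x ω e * P.a (Sum.inl e) k +
      ∑ t : Fin P.T with t.1 < n,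
        ((P.samp η x ω).pick t).elim 0 fun e => P.a (Sum.inr e) k := by
  induction n with
  | zero => simp [consumption]
  | succ n ih =>
    rw [consumption, ih, add_assoc]
    congr 1
    split_ifs with h
    · have hf : Finset.univ.filter (fun t : Fin P.T => t.1 < n + 1) =
          insert ⟨n, h⟩ (Finset.univ.filter fun t : Fin P.T => t.1 < n) := by
        ext t
        simp only [Finset.mem_filter, Finset.mem_univ, true_and, Finset.mem_insert, Fin.ext_iff]
        omega
      rw [hf, Finset.sum_insert (by simp), add_comm]
      rfl
    · have hf : Finset.univ.filter (fun t : Fin P.T => t.1 < n + 1) =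
          Finset.univ.filter fun t : Fin P.T => t.1 < n := by
        ext t
        have := t.2
        simp only [Finset.mem_filter, Finset.mem_univ, true_and]
        omega
      rw [hf, add_zero]

theorem samp_cost_le_budget (k) : (P.samp η x ω).cost k ≤ P.budget k := by
  have h := P.consumption_eq η x ω P.T k
  rw [Finset.filter_true_of_mem fun t _ => t.2] at h
  exact (h.symm.trans_le (P.consumption_le_budget η x ω P.T k) :)

/-- The indicator that `e` is the edge sampled in round `t`. -/
def sampled (ω : P.Coins) (e : P.E₂) (t : Fin P.T) : ℝ :=
  open scoped Classical in if (ω.2 t).2 = some e then 1 else 0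

theorem sampled_nonneg (e t) : 0 ≤ P.sampled ω e t := by
  unfold sampled
  split_ifs <;> norm_num

theorem elim_pick_le (t : Fin P.T) {c : P.E₂ → ℝ} (hc : ∀ e, 0 ≤ c e) :
    ((P.samp η x ω).pick t).elim 0 c ≤ ∑ e, P.sampled ω e t * c e := by
  have h0 : ∀ e ∈ Finset.univ, 0 ≤ P.sampled ω e t * c e := fun e _ =>
    mul_nonneg (P.sampled_nonneg ω e t) (hc e)
  cases ho : (P.samp η x ω).pick t with
  | none => exact Finset.sum_nonneg h0
  | some e =>
    refine le_trans (le_of_eq ?_) (Finset.single_le_sum h0 (Finset.mem_univ e))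
    have := (P.accept_eq_some ho).1
    simp [sampled, this]

/-- Passing from selected to sampled edges, and from earlier rounds to all rounds other than `t`,
only increases the bound. It removes the dependence on the acceptance decisions and leaves a
quantity independent of the sample of round `t`. -/
theorem consumption_le_sampled (t : Fin P.T) (k) : P.consumption η x ω t k ≤
    ∑ e, P.sampledCopies η x ω e * P.a (Sum.inl e) k +
      ∑ s ∈ Finset.univ.erase t, ∑ e, P.sampled ω e s * P.a (Sum.inr e) k := by
  rw [consumption_eq]
  refine add_le_add (Finset.sum_le_sum fun e _ => mul_le_mul_of_nonneg_right
    (Nat.cast_le.2 (P.keptCopies_le_sampledCopies η x ω e)) (P.a_nonneg _ _)) ?_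
  refine (Finset.sum_le_sum fun s _ => P.elim_pick_le η x ω s fun e => P.a_nonneg _ k).trans ?_
  refine Finset.sum_le_sum_of_subset_of_nonneg (fun s hs => ?_) fun s _ _ =>
    Finset.sum_nonneg fun e _ => mul_nonneg (P.sampled_nonneg ω e s) (P.a_nonneg _ k)
  simp only [Finset.mem_filter, Finset.mem_univ, true_and] at hs
  simp only [Finset.mem_erase, Finset.mem_univ, and_true]
  rintro rfl
  exact lt_irrefl _ hs

/-- The consumption of a resource that every violation of its budget implies, up to the
consumption of the edge responsible for the violation. -/
def threshold : K₁ ⊕ K₂ → ℝ :=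
  Sum.elim (fun k => P.budget (Sum.inl k)) fun k => P.budget (Sum.inr k) - 1

theorem exists_nat_offline_cost (c : P.E₁ → ℕ) (k : K₁) :
    ∃ n : ℕ, ∑ e, c e * P.a (Sum.inl e) (Sum.inl k) = n := by
  have h : ∀ e : P.E₁, ∃ n : ℕ, c e * P.a (Sum.inl e) (Sum.inl k) = n := fun e => by
    rcases P.a_integral (Sum.inl e) k with h | h
    · exact ⟨0, by simp [h]⟩
    · exact ⟨c e, by simp [h]⟩
  choose m hm using h
  exact ⟨∑ e, m e, by push_cast; exact Finset.sum_congr rfl fun e _ => hm e⟩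

theorem exists_nat_consumption (n : ℕ) (k : K₁) :
    ∃ m : ℕ, P.consumption η x ω n (Sum.inl k) = m := by
  induction n with
  | zero => exact P.exists_nat_offline_cost _ k
  | succ n ih =>
    obtain ⟨m, hm⟩ := ih
    rw [consumption, hm]
    split_ifs with h
    · cases P.accept (P.consumption η x ω n) (ω.2 ⟨n, h⟩).2 with
      | none => exact ⟨m, by simp⟩
      | some e =>
        rcases P.a_integral (Sum.inr e) k with h | h
        · exact ⟨m, by simp [h]⟩
        · exact ⟨m + 1, by simp [h]⟩
    · exact ⟨m, by simp⟩

/-- For an integral resource nothing is lost: budget and consumption are integers and the request is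
1, so a violation means that the budget was already used up. Otherwise the request, at most 1, is
the unit subtracted in `threshold`. -/
theorem threshold_le_consumption {n : ℕ} {e : P.E₂} {k} (ha : 0 < P.a (Sum.inr e) k)
    (h : P.budget k < P.consumption η x ω n k + P.a (Sum.inr e) k) :
    P.threshold k ≤ P.consumption η x ω n k := by
  rcases k with k | k
  · obtain ⟨m, hm⟩ := P.exists_nat_consumption η x ω n k
    obtain ⟨b, hb⟩ := P.budget_integral k
    have h1 := (P.a_integral (Sum.inr e) k).resolve_left ha.ne'
    rw [hm, hb, h1] at h
    have h2 : b < m + 1 := by exact_mod_cast h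
    simp only [threshold, Sum.elim_inl, hm, hb]
    exact_mod_cast Nat.lt_succ_iff.1 h2
  · have := P.a_le_one (Sum.inr e) (Sum.inr k)
    simp only [threshold, Sum.elim_inr]
    linarith

variable {η x} in
theorem sampledCopies_le (e) (h : 0 ≤ η * x e) : (P.sampledCopies η x ω e : ℝ) ≤ η * x e + 1 := by
  unfold sampledCopies rounded
  split_ifs
  · exact (Nat.ceil_lt_add_one h).le
  · linarith [Nat.floor_le h]

-- Rounding adds at most one copy of `e` to its mean, which costs at most one unit of `k`. For an
-- integral resource an overrun is by at least a whole unit, which pays for that copy; otherwise it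
-- is paid by the unit subtracted in `threshold`.
open scoped Classical in
variable {η x} in
theorem threshold_sub_le_of_overrun {e : P.E₁} {k} (hx : 0 ≤ η * x e)
    (ha : 0 < P.a (Sum.inl e) k) (h : P.Overrun η x ω k) :
    P.threshold k - η * x e * P.a (Sum.inl e) k ≤
      ∑ e' ∈ Finset.univ.erase e, P.sampledCopies η x ω e' * P.a (Sum.inl e') k := by
  have hN := P.sampledCopies_le ω e hx
  have hS := Finset.add_sum_erase Finset.univ
    (fun e' => P.sampledCopies η x ω e' * P.a (Sum.inl e') k) (Finset.mem_univ e)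
  unfold Overrun at h
  rcases k with k | k
  · obtain ⟨m, hm⟩ := P.exists_nat_offline_cost (P.sampledCopies η x ω) k
    obtain ⟨b, hb⟩ := P.budget_integral k
    have h1 := (P.a_integral (Sum.inl e) k).resolve_left ha.ne'
    rw [hm, hb] at h
    have h2 : (b : ℝ) + 1 ≤ m := by
      have : b < m := by exact_mod_cast h
      exact_mod_cast this
    simp only [threshold, Sum.elim_inl, hb, h1]
    simp only [hm, h1] at hS
    linarith
  · have h1 := P.a_le_one (Sum.inl e) (Sum.inr k)
    have h2 := mul_le_mul_of_nonneg_right hN ha.le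
    simp only [threshold, Sum.elim_inr]
    linarith

end pathwise

end TSRA

namespace TSRA

variable {I H J K₁ K₂ : Type*} [Fintype J] {P : TSRA I H J K₁ K₂}

/-! ### First and mixed second moments of the samples -/

section moments

theorem expect_roundCoin {v : ℝ} (hv : 0 ≤ v) :
    (roundCoin v).expect (fun b => (rounded v b : ℝ)) = v := by
  rw [roundCoin, expect_pmfOfReal]
  have hf : (⌊v⌋₊ : ℝ) = v - Int.fract v := by
    rw [natCast_floor_eq_intCast_floor hv, Int.self_sub_fract]
  simp only [Fintype.sum_bool, rounded, if_true, Bool.false_eq_true, if_false, hf]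
  -- At integers the ceiling is not the floor plus one, but rounding up then has probability 0.
  rcases eq_or_ne (Int.fract v) 0 with h | h
  · simp [h]
  · have hc : (⌈v⌉₊ : ℝ) = v - Int.fract v + 1 := by
      rw [natCast_ceil_eq_intCast_ceil hv, Int.self_sub_fract,
        (Int.ceil_eq_floor_add_one_iff_notMem v).2 fun hm => h (by
          obtain ⟨z, rfl⟩ := hm
          exact Int.fract_intCast z)]
      push_cast
      ring
    rw [hc]
    ring

variable {x : P.E₁ → ℝ} {y : P.E₂ → Fin P.T → ℝ}

/-- `sampleProb` divides by the arrival probability, with value 0 when that probability vanishes.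
Since `y` vanishes there too, the unconditional sampling probability is `α * y e t` in every case.
-/
theorem IsFeasible.y_eq_zero (h : P.IsFeasible x y) {e : P.E₂} {t} (hp : P.p e.1.2 t = 0) :
    y e t = 0 := by
  classical
  have h1 : ∑ e' with e'.1.2 = e.1.2, y e' t ≤ P.p e.1.2 t := by convert h.arrival e.1.2 t
  have h2 := Finset.single_le_sum (f := fun e' => y e' t) (fun e' _ => h.y_nonneg e' t)
    (Finset.mem_filter.2 ⟨Finset.mem_univ e, rfl⟩ :
      e ∈ Finset.univ.filter fun e' : P.E₂ => e'.1.2 = e.1.2)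
  exact le_antisymm (hp ▸ h2.trans h1) (h.y_nonneg e t)

open scoped Classical in
theorem expect_roundLaw (h : P.IsFeasible x y) (α : Set.Ioc (0 : ℝ) 1) (t : Fin P.T) (e : P.E₂) :
    (roundLaw h α t).expect (fun r => if r.2 = some e then (1 : ℝ) else 0) = α * y e t := by
  rw [roundLaw, PMF.expect_bind_pair]
  have h1 : ∀ j, (sampleLaw h α t j).expect (fun o => if o = some e then (1 : ℝ) else 0) =
      P.sampleProb α y t j e := by
    intro j
    rw [sampleLaw, expect_pmfOfReal, Fintype.sum_eq_single (some e)]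
    · simp
    · intro o ho
      simp [ho]
  simp only [h1]
  rw [arrivalLaw, expect_pmfOfReal, Fintype.sum_eq_single e.1.2]
  · rw [sampleProb, if_pos rfl]
    by_cases hp : P.p e.1.2 t = 0
    · simp [h.y_eq_zero hp]
    · field_simp
  · intro j hj
    simp [sampleProb, hj.symm]

variable (h : P.IsFeasible x y) (η α : Set.Ioc (0 : ℝ) 1)

open scoped Classical in
theorem expect_sampledCopies (e) :
    (coinLaw h η α).expect (fun ω => (P.sampledCopies η x ω e : ℝ)) = η * x e := by
  have := PMF.expect_bind_map_mul (pmfPi fun e => roundCoin (η * x e))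
    (pmfPi fun t => roundLaw h α t) (fun b => (rounded (η * x e) (b e) : ℝ)) fun _ => 1
  simp only [mul_one, PMF.expect_const] at this
  refine this.trans ?_
  rw [expect_pmfPi_single (fun e => roundCoin (η * x e)) e fun b => (rounded (η * x e) b : ℝ)]
  exact expect_roundCoin (mul_nonneg η.2.1.le (h.x_nonneg e))

open scoped Classical in
theorem expect_sampledCopies_mul {e e'} (he : e ≠ e') :
    (coinLaw h η α).expect
      (fun ω => (P.sampledCopies η x ω e : ℝ) * P.sampledCopies η x ω e') =
      η * x e * (η * x e') := by
  have := PMF.expect_bind_map_mul (pmfPi fun e => roundCoin (η * x e))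
    (pmfPi fun t => roundLaw h α t)
    (fun b => (rounded (η * x e) (b e) : ℝ) * rounded (η * x e') (b e')) fun _ => 1
  simp only [mul_one, PMF.expect_const] at this
  refine this.trans ?_
  rw [expect_pmfPi_pair (fun e => roundCoin (η * x e)) he (fun b => (rounded (η * x e) b : ℝ))
      fun b => (rounded (η * x e') b : ℝ),
    expect_roundCoin (mul_nonneg η.2.1.le (h.x_nonneg e)),
    expect_roundCoin (mul_nonneg η.2.1.le (h.x_nonneg e'))]

open scoped Classical in
theorem expect_sampled (e t) :
    (coinLaw h η α).expect (fun ω => P.sampled ω e t) = α * y e t := by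
  have := PMF.expect_bind_map_mul (pmfPi fun e => roundCoin (η * x e))
    (pmfPi fun t => roundLaw h α t) (fun _ => 1)
    fun r => if (r t).2 = some e then (1 : ℝ) else 0
  simp only [one_mul, PMF.expect_const] at this
  refine this.trans ?_
  rw [expect_pmfPi_single (fun t => roundLaw h α t) t
    fun r => if r.2 = some e then (1 : ℝ) else 0]
  exact expect_roundLaw h α t e

open scoped Classical in
theorem expect_sampled_mul (e e') {t s} (hts : t ≠ s) :
    (coinLaw h η α).expect (fun ω => P.sampled ω e t * P.sampled ω e' s) =
      α * y e t * (α * y e' s) := by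
  have := PMF.expect_bind_map_mul (pmfPi fun e => roundCoin (η * x e))
    (pmfPi fun t => roundLaw h α t) (fun _ => 1)
    fun r => (if (r t).2 = some e then (1 : ℝ) else 0) * if (r s).2 = some e' then (1 : ℝ) else 0
  simp only [one_mul, PMF.expect_const] at this
  refine this.trans ?_
  rw [expect_pmfPi_pair (fun t => roundLaw h α t) hts
      (fun r => if r.2 = some e then (1 : ℝ) else 0)
      fun r => if r.2 = some e' then (1 : ℝ) else 0,
    expect_roundLaw, expect_roundLaw]

open scoped Classical in
theorem expect_sampled_mul_sampledCopies (e e' t) :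
    (coinLaw h η α).expect (fun ω => P.sampled ω e t * P.sampledCopies η x ω e') =
      α * y e t * (η * x e') := by
  have := PMF.expect_bind_map_mul (pmfPi fun e => roundCoin (η * x e))
    (pmfPi fun t => roundLaw h α t) (fun b => (rounded (η * x e') (b e') : ℝ))
    fun r => if (r t).2 = some e then (1 : ℝ) else 0
  rw [expect_pmfPi_single (fun e => roundCoin (η * x e)) e' fun b => (rounded (η * x e') b : ℝ),
    expect_pmfPi_single (fun t => roundLaw h α t) t
      fun r => if r.2 = some e then (1 : ℝ) else 0,
    expect_roundCoin (mul_nonneg η.2.1.le (h.x_nonneg e')), expect_roundLaw] at this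
  rw [mul_comm, ← this]
  congr 1
  funext ω
  exact mul_comm _ _

end moments

/-! ### Loss caused by each resource, and the resulting profit bound -/

section phases

variable {x : P.E₁ → ℝ} {y : P.E₂ → Fin P.T → ℝ} (h : P.IsFeasible x y) (θ : Set.Ioc (0 : ℝ) 1)
  {ε : ℝ}

-- Markov's inequality for the copies of the other edges, weighted by the independent number of
-- copies of `e`. The mean consumption of `e` itself is subtracted both from the threshold and from
-- the expected total, so that only independent factors remain.
open scoped Classical in
theorem expect_sampledCopies_overrun_le {e : P.E₁} {k} (ha : 0 < P.a (Sum.inl e) k)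
    (hε : 0 ≤ ε) (hθ : θ * (1 + ε) < 1) (hD : 0 < P.threshold k)
    (hB : P.budget k ≤ (1 + ε) * P.threshold k) :
    (coinLaw h θ θ).expect (fun ω =>
      if P.Overrun θ x ω k then (P.sampledCopies θ x ω e : ℝ) else 0) ≤
      θ * x e * (θ * (1 + ε)) := by
  have hθ0 : (0 : ℝ) < θ := θ.2.1
  have hv : 0 ≤ θ * x e := mul_nonneg hθ0.le (h.x_nonneg e)
  set S := ∑ e' ∈ Finset.univ.erase e, θ * x e' * P.a (Sum.inl e') k with hS
  set c := P.threshold k - θ * x e * P.a (Sum.inl e) k with hc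
  have htot : θ * x e * P.a (Sum.inl e) k + S ≤ θ * P.budget k := by
    have h1 := h.resource k
    have h2 : 0 ≤ ∑ e, ∑ t, y e t * P.a (Sum.inr e) k := Finset.sum_nonneg fun e _ =>
      Finset.sum_nonneg fun t _ => mul_nonneg (h.y_nonneg e t) (P.a_nonneg _ _)
    have h3 := Finset.add_sum_erase Finset.univ
      (fun e' => θ * x e' * P.a (Sum.inl e') k) (Finset.mem_univ e)
    rw [hS, h3]
    simp only [mul_assoc, ← Finset.mul_sum]
    exact mul_le_mul_of_nonneg_left (by linarith) hθ0.le
  have hS0 : 0 ≤ S := Finset.sum_nonneg fun e' _ =>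
    mul_nonneg (mul_nonneg hθ0.le (h.x_nonneg e')) (P.a_nonneg _ _)
  have hB' : θ * P.budget k ≤ θ * (1 + ε) * P.threshold k := by
    rw [mul_assoc]
    exact mul_le_mul_of_nonneg_left hB hθ0.le
  have hlt : θ * (1 + ε) * P.threshold k < P.threshold k := by
    nlinarith
  have hc0 : 0 < c := by linarith
  have hva : 0 ≤ θ * x e * P.a (Sum.inl e) k := mul_nonneg hv ha.le
  -- Subtracting the same nonnegative amount from both sides of the bound on the total does no harm,
  -- because the factor `θ * (1 + ε)` is below 1.
  have hSc : S ≤ θ * (1 + ε) * c := by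
    rw [hc]
    nlinarith
  calc _ ≤ (coinLaw h θ θ).expect (fun ω => c⁻¹ * ∑ e' ∈ Finset.univ.erase e,
          ((P.sampledCopies θ x ω e : ℝ) * P.sampledCopies θ x ω e') * P.a (Sum.inl e') k) := by
        refine PMF.expect_mono _ fun ω => ?_
        simp only [mul_assoc, ← Finset.mul_sum]
        have hR : 0 ≤ ∑ e' ∈ Finset.univ.erase e,
            (P.sampledCopies θ x ω e' : ℝ) * P.a (Sum.inl e') k :=
          Finset.sum_nonneg fun e' _ => mul_nonneg (Nat.cast_nonneg _) (P.a_nonneg _ _)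
        split_ifs with ho
        -- On the overrun event the consumption by the other edges is at least `c`, so its quotient
        -- by `c` dominates the indicator.
        · have h1 := P.threshold_sub_le_of_overrun ω hv ha ho
          rw [mul_left_comm]
          refine le_mul_of_one_le_right (Nat.cast_nonneg _) ?_
          exact (inv_mul_cancel₀ hc0.ne').ge.trans (mul_le_mul_of_nonneg_left h1 (inv_nonneg.2 hc0.le))
        · positivity
    _ = c⁻¹ * (θ * x e * S) := by
        rw [PMF.expect_const_mul]
        congr 1
        rw [PMF.expect_sum, hS, Finset.mul_sum]
        refine Finset.sum_congr rfl fun e' he' => ?_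
        rw [PMF.expect_mul_const, expect_sampledCopies_mul h θ θ (Finset.ne_of_mem_erase he').symm,
          mul_assoc (_ * _)]
    _ ≤ c⁻¹ * (θ * x e * (θ * (1 + ε) * c)) := by gcongr
    _ = _ := by field_simp

-- The same Markov argument. The sample of round `t` is not part of the consumption before that
-- round, so no correction for the edge's own mean is needed, and hence no condition `θ * (1 + ε) <
-- 1`.
open scoped Classical in
theorem expect_sampled_exceeded_le (e : P.E₂) (t : Fin P.T) {k} (ha : 0 < P.a (Sum.inr e) k)
    (hD : 0 < P.threshold k) (hB : P.budget k ≤ (1 + ε) * P.threshold k) :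
    (coinLaw h θ θ).expect (fun ω =>
      if P.budget k < P.consumption θ x ω t k + P.a (Sum.inr e) k
        then P.sampled ω e t else 0) ≤ θ * y e t * (θ * (1 + ε)) := by
  have hθ0 : (0 : ℝ) < θ := θ.2.1
  have hv : 0 ≤ θ * y e t := mul_nonneg hθ0.le (h.y_nonneg e t)
  set c := P.threshold k with hc
  have htot : ∑ e', θ * x e' * P.a (Sum.inl e') k +
      ∑ s ∈ Finset.univ.erase t, ∑ e', θ * y e' s * P.a (Sum.inr e') k ≤ θ * P.budget k := by
    have h1 := h.resource k
    have h2 : ∑ s ∈ Finset.univ.erase t, ∑ e', y e' s * P.a (Sum.inr e') k ≤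
        ∑ e', ∑ s, y e' s * P.a (Sum.inr e') k := by
      rw [Finset.sum_comm (s := Finset.univ (α := P.E₂))]
      exact Finset.sum_le_sum_of_subset_of_nonneg (Finset.erase_subset _ _) fun s _ _ =>
        Finset.sum_nonneg fun e' _ => mul_nonneg (h.y_nonneg e' s) (P.a_nonneg _ _)
    simp only [mul_assoc, ← Finset.mul_sum, ← mul_add]
    exact mul_le_mul_of_nonneg_left (by linarith) hθ0.le
  have hB' : θ * P.budget k ≤ θ * (1 + ε) * c := by
    rw [mul_assoc]
    exact mul_le_mul_of_nonneg_left hB hθ0.le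
  calc _ ≤ (coinLaw h θ θ).expect (fun ω => c⁻¹ *
          (∑ e', (P.sampled ω e t * P.sampledCopies θ x ω e') * P.a (Sum.inl e') k +
            ∑ s ∈ Finset.univ.erase t, ∑ e',
              (P.sampled ω e t * P.sampled ω e' s) * P.a (Sum.inr e') k)) := by
        refine PMF.expect_mono _ fun ω => ?_
        have hz := P.sampled_nonneg ω e t
        simp only [mul_assoc, ← Finset.mul_sum, ← mul_add]
        have hu := P.consumption_le_sampled θ x ω t k
        split_ifs with ho
        · have h1 := (P.threshold_le_consumption θ x ω ha ho).trans hu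
          rw [mul_left_comm]
          refine le_mul_of_one_le_right hz ?_
          exact (inv_mul_cancel₀ hD.ne').ge.trans (mul_le_mul_of_nonneg_left h1 (inv_nonneg.2 hD.le))
        · refine mul_nonneg (inv_nonneg.2 hD.le) (mul_nonneg hz (add_nonneg ?_ ?_))
          · exact Finset.sum_nonneg fun e' _ => mul_nonneg (Nat.cast_nonneg _) (P.a_nonneg _ _)
          · exact Finset.sum_nonneg fun s _ => Finset.sum_nonneg fun e' _ =>
              mul_nonneg (P.sampled_nonneg ω e' s) (P.a_nonneg _ _)
    _ = c⁻¹ * (θ * y e t * (∑ e', θ * x e' * P.a (Sum.inl e') k +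
          ∑ s ∈ Finset.univ.erase t, ∑ e', θ * y e' s * P.a (Sum.inr e') k)) := by
        rw [PMF.expect_const_mul]
        congr 1
        rw [PMF.expect_add, PMF.expect_sum, PMF.expect_sum, mul_add, Finset.mul_sum,
          Finset.mul_sum]
        congr 1
        · refine Finset.sum_congr rfl fun e' _ => ?_
          rw [PMF.expect_mul_const, expect_sampled_mul_sampledCopies, mul_assoc (_ * _)]
        · refine Finset.sum_congr rfl fun s hs => ?_
          rw [PMF.expect_sum, Finset.mul_sum]
          refine Finset.sum_congr rfl fun e' _ => ?_
          rw [PMF.expect_mul_const,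
            expect_sampled_mul h θ θ e e' (Finset.ne_of_mem_erase hs).symm, mul_assoc (_ * _)]
    _ ≤ c⁻¹ * (θ * y e t * (θ * (1 + ε) * c)) := by
        gcongr
        exact htot.trans hB'
    _ = _ := by field_simp

variable [Fintype K₁] [Fintype K₂]

open scoped Classical in
theorem IsSparse.card_le {ℓ₁ ℓ₂ : ℕ} (hs : P.IsSparse ℓ₁ ℓ₂) (e) :
    (Finset.univ.filter fun k => 0 < P.a e k).card ≤ ℓ₁ + ℓ₂ := by
  rw [Finset.card_filter, Fintype.sum_sum_type, ← Finset.card_filter, ← Finset.card_filter]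
  refine add_le_add ?_ ?_
  · convert (hs e).1
  · convert (hs e).2

-- Union bound: copies are lost only if some requested resource is overrun, and each such resource
-- accounts for at most the share computed above.
open scoped Classical in
theorem le_expect_keptCopies {ℓ₁ ℓ₂ : ℕ} (hs : P.IsSparse ℓ₁ ℓ₂)
    (hε : 0 ≤ ε) (hθ : θ * (1 + ε) < 1)
    (hk : ∀ e k, 0 < P.a e k → 0 < P.threshold k ∧ P.budget k ≤ (1 + ε) * P.threshold k)
    (e : P.E₁) :
    θ * x e * (1 - (ℓ₁ + ℓ₂) * (θ * (1 + ε))) ≤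
      (coinLaw h θ θ).expect (fun ω => (P.keptCopies θ x ω e : ℝ)) := by
  set K := Finset.univ.filter fun k => 0 < P.a (Sum.inl e) k with hK
  have hv : 0 ≤ θ * x e := mul_nonneg θ.2.1.le (h.x_nonneg e)
  have hθε : 0 ≤ θ * (1 + ε) := mul_nonneg θ.2.1.le (by linarith)
  have h1 : (coinLaw h θ θ).expect (fun ω => (P.sampledCopies θ x ω e : ℝ) -
      ∑ k ∈ K, if P.Overrun θ x ω k then (P.sampledCopies θ x ω e : ℝ) else 0) ≤
      (coinLaw h θ θ).expect (fun ω => (P.keptCopies θ x ω e : ℝ)) := by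
    refine PMF.expect_mono _ fun ω => ?_
    have h0 : ∀ k ∈ K, 0 ≤
        if P.Overrun θ x ω k then (P.sampledCopies θ x ω e : ℝ) else 0 := fun k _ => by
      split_ifs <;> positivity
    unfold keptCopies
    split_ifs with ho
    · obtain ⟨k, hak, hok⟩ := ho
      have := Finset.single_le_sum h0 (Finset.mem_filter.2 ⟨Finset.mem_univ k, hak⟩)
      rw [if_pos hok] at this
      rw [Nat.cast_zero]
      linarith
    · linarith [Finset.sum_nonneg h0]
  refine le_trans ?_ h1
  rw [PMF.expect_sub, PMF.expect_sum, expect_sampledCopies]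
  have h2 : ∑ k ∈ K, (coinLaw h θ θ).expect
      (fun ω => if P.Overrun θ x ω k then (P.sampledCopies θ x ω e : ℝ) else 0) ≤
      K.card • (θ * x e * (θ * (1 + ε))) := Finset.sum_le_card_nsmul _ _ _ fun k hk' => by
    have hak := (Finset.mem_filter.1 hk').2
    exact expect_sampledCopies_overrun_le h θ hak hε hθ (hk _ k hak).1 (hk _ k hak).2
  have h3 : (K.card : ℝ) ≤ ℓ₁ + ℓ₂ := by exact_mod_cast hs.card_le (Sum.inl e)
  have h4 := mul_le_mul_of_nonneg_right h3 (mul_nonneg hv hθε)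
  rw [nsmul_eq_mul] at h2
  linarith

open scoped Classical in
theorem le_expect_pick {ℓ₁ ℓ₂ : ℕ} (hs : P.IsSparse ℓ₁ ℓ₂) (hε : 0 ≤ ε)
    (hk : ∀ e k, 0 < P.a e k → 0 < P.threshold k ∧ P.budget k ≤ (1 + ε) * P.threshold k)
    (e : P.E₂) (t : Fin P.T) :
    θ * y e t * (1 - (ℓ₁ + ℓ₂) * (θ * (1 + ε))) ≤
      (coinLaw h θ θ).expect
        (fun ω => if (P.samp θ x ω).pick t = some e then (1 : ℝ) else 0) := by
  set K := Finset.univ.filter fun k => 0 < P.a (Sum.inr e) k with hK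
  have hv : 0 ≤ θ * y e t := mul_nonneg θ.2.1.le (h.y_nonneg e t)
  have hθε : 0 ≤ θ * (1 + ε) := mul_nonneg θ.2.1.le (by linarith)
  have h1 : (coinLaw h θ θ).expect (fun ω => P.sampled ω e t -
      ∑ k ∈ K, if P.budget k < P.consumption θ x ω t k + P.a (Sum.inr e) k
        then P.sampled ω e t else 0) ≤
      (coinLaw h θ θ).expect
        (fun ω => if (P.samp θ x ω).pick t = some e then (1 : ℝ) else 0) := by
    refine PMF.expect_mono _ fun ω => ?_
    have hz := P.sampled_nonneg ω e t
    have h0 : ∀ k ∈ K, 0 ≤ if P.budget k < P.consumption θ x ω t k + P.a (Sum.inr e) k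
        then P.sampled ω e t else 0 := fun k _ => by
      split_ifs
      · exact hz
      · exact le_rfl
    have hsum := Finset.sum_nonneg h0
    split_ifs with hp
    · have : P.sampled ω e t ≤ 1 := by unfold sampled; split_ifs <;> norm_num
      linarith
    · by_cases hse : (ω.2 t).2 = some e
      · have hex : ∃ k, P.budget k < P.consumption θ x ω t k + P.a (Sum.inr e) k := by
          by_contra! hcon
          refine hp ?_
          simp only [samp, accept, hse, Option.bind_some]
          rw [if_pos hcon]
        obtain ⟨k, hk'⟩ := hex
        -- The consumption before the round respects every budget, so a resource violated by adding
        -- `e` must be requested by `e`, and the union bound ranges over requested resources only.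
        have hak : 0 < P.a (Sum.inr e) k := by
          have := P.consumption_le_budget θ x ω t k
          linarith
        have := Finset.single_le_sum h0 (Finset.mem_filter.2 ⟨Finset.mem_univ k, hak⟩)
        rw [if_pos hk'] at this
        linarith
      · have : P.sampled ω e t = 0 := if_neg hse
        linarith
  refine le_trans ?_ h1
  rw [PMF.expect_sub, PMF.expect_sum, expect_sampled]
  have h2 : ∑ k ∈ K, (coinLaw h θ θ).expect
      (fun ω => if P.budget k < P.consumption θ x ω t k + P.a (Sum.inr e) k
        then P.sampled ω e t else 0) ≤
      K.card • (θ * y e t * (θ * (1 + ε))) := Finset.sum_le_card_nsmul _ _ _ fun k hk' => by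
    have hak := (Finset.mem_filter.1 hk').2
    exact expect_sampled_exceeded_le h θ e t hak (hk _ k hak).1 (hk _ k hak).2
  have h3 : (K.card : ℝ) ≤ ℓ₁ + ℓ₂ := by exact_mod_cast hs.card_le (Sum.inr e)
  have h4 := mul_le_mul_of_nonneg_right h3 (mul_nonneg hv hθε)
  rw [nsmul_eq_mul] at h2
  linarith

omit [Fintype K₁] [Fintype K₂] in
open scoped Classical in
theorem expectedProfit_eq : P.expectedProfit h θ θ =
    ∑ e, P.w (Sum.inl e) * (coinLaw h θ θ).expect (fun ω => (P.keptCopies θ x ω e : ℝ)) +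
    ∑ e, ∑ t, P.w (Sum.inr e) * (coinLaw h θ θ).expect
        (fun ω => if (P.samp θ x ω).pick t = some e then (1 : ℝ) else 0) := by
  have h1 : P.expectedProfit h θ θ =
      (coinLaw h θ θ).expect fun ω => (P.samp θ x ω).profit := rfl
  have h2 : ∀ o : Option P.E₂, o.elim 0 (fun e => P.w (Sum.inr e)) =
      ∑ e, P.w (Sum.inr e) * if o = some e then (1 : ℝ) else 0 := by
    rintro (_ | e) <;> simp
  simp only [h1, Allocation.profit, h2]
  rw [PMF.expect_add, PMF.expect_sum, PMF.expect_sum, Finset.sum_comm (s := Finset.univ (α := P.E₂))]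
  simp only [PMF.expect_sum, PMF.expect_const_mul]
  rfl

theorem le_expectedProfit {ℓ₁ ℓ₂ : ℕ} (hs : P.IsSparse ℓ₁ ℓ₂)
    (hε : 0 ≤ ε) (hθ : θ * (1 + ε) < 1)
    (hk : ∀ e k, 0 < P.a e k → 0 < P.threshold k ∧ P.budget k ≤ (1 + ε) * P.threshold k) :
    (θ : ℝ) * (1 - (ℓ₁ + ℓ₂) * (θ * (1 + ε))) * P.lpValue x y ≤ P.expectedProfit h θ θ := by
  rw [expectedProfit_eq, lpValue, mul_add, Finset.mul_sum, Finset.mul_sum]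
  refine add_le_add (Finset.sum_le_sum fun e _ => ?_) (Finset.sum_le_sum fun e _ => ?_)
  · have := mul_le_mul_of_nonneg_left (le_expect_keptCopies h θ hs hε hθ hk e)
      (P.w_pos (Sum.inl e)).le
    exact le_trans (le_of_eq (by ring)) this
  · rw [Finset.mul_sum]
    refine Finset.sum_le_sum fun t _ => ?_
    have := mul_le_mul_of_nonneg_left (le_expect_pick h θ hs hε hk e t)
      (P.w_pos (Sum.inr e)).le
    exact le_trans (le_of_eq (by ring)) this

end phases

end TSRA

/-! ### Admissibility of almost every run -/

theorem support_pmfPi {ι β : Type*} [Fintype ι] [Fintype β] (q : ι → PMF β) {r : ι → β}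
    (hr : r ∈ (pmfPi q).support) (i : ι) : r i ∈ (q i).support := by
  rw [PMF.mem_support_iff] at hr
  change ∏ i, q i (r i) ≠ 0 at hr
  rw [Finset.prod_ne_zero_iff] at hr
  exact (PMF.mem_support_iff _ _).2 (hr i (Finset.mem_univ i))

theorem option_elim_eq_sum {E : Type*} [Fintype E] [DecidableEq E] (o : Option E) (c : E → ℝ) :
    o.elim 0 c = ∑ e, (if o = some e then (1 : ℝ) else 0) * c e := by
  cases o <;> simp

namespace TSRA

variable {I H J K₁ K₂ : Type*} [Fintype J] {P : TSRA I H J K₁ K₂}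

section admissible

variable {x : P.E₁ → ℝ} {y : P.E₂ → Fin P.T → ℝ}

theorem samp_isAdmissible (h : P.IsFeasible x y) (η α : Set.Ioc (0 : ℝ) 1) {ω : P.Coins}
    (hω : ω ∈ (coinLaw h η α).support) : (P.samp η x ω).IsAdmissible (P.arrivals ω) := by
  refine ⟨fun t e he => ?_, P.samp_cost_le_budget η x ω⟩
  have hs := (P.accept_eq_some he).1
  simp only [coinLaw, PMF.mem_support_bind_iff, PMF.mem_support_map_iff] at hω
  obtain ⟨b, _, r, hr, rfl⟩ := hω
  have ht := support_pmfPi _ hr t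
  simp only [roundLaw, PMF.mem_support_bind_iff, PMF.mem_support_map_iff] at ht
  obtain ⟨j, _, o, ho, hjo⟩ := ht
  have h1 : j = P.arrivals (b, r) t := congrArg Prod.fst hjo
  have h2 : o = some e := (congrArg Prod.snd hjo).trans hs
  rw [← h1]
  subst h2
  by_contra hne
  -- An edge not incident to the arriving vertex has sampling probability 0, hence lies outside the
  -- support.
  simp [sampleLaw, pmfOfReal, sampleProb, hne] at ho

end admissible

/-! ### The LP dominates the expected offline optimum -/

section opt

/-- The slack `δ` avoids having to show that the supremum is attained. Boundedness of the profits is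
not needed either: only nonemptiness is used, provided by the empty allocation. -/
theorem exists_allocation_near_opt (σ : Fin P.T → J) {δ : ℝ} (hδ : 0 < δ) :
    ∃ A : P.Allocation, A.IsAdmissible σ ∧ P.offlineOpt σ - δ ≤ A.profit := by
  have hne : {v | ∃ A : P.Allocation, A.IsAdmissible σ ∧ v = A.profit}.Nonempty :=
    ⟨_, ⟨fun _ => 0, fun _ => none⟩, ⟨by simp, fun k => by
      simpa [Allocation.cost] using (P.budget_pos k).le⟩, rfl⟩
  obtain ⟨v, ⟨A, hA, rfl⟩, hv⟩ := exists_lt_of_lt_csSup hne (sub_lt_self (P.offlineOpt σ) hδ)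
  exact ⟨A, hA, hv.le⟩

theorem offlineOpt_nonneg (σ : Fin P.T → J) : 0 ≤ P.offlineOpt σ := by
  refine Real.sSup_nonneg ?_
  rintro _ ⟨A, _, rfl⟩
  exact A.profit_nonneg

theorem expectedOpt_nonneg : 0 ≤ P.expectedOpt :=
  Finset.sum_nonneg fun σ _ =>
    mul_nonneg (Finset.prod_nonneg fun t _ => P.p_nonneg _ t) (offlineOpt_nonneg σ)

/-- Averaging allocations over the arrival sequence gives a feasible solution of the benchmark LP
whose value is the average profit. -/
theorem exists_isFeasible_lpValue_eq (A : (Fin P.T → J) → P.Allocation)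
    (hA : ∀ σ, (A σ).IsAdmissible σ) :
    ∃ x y, P.IsFeasible x y ∧
      P.lpValue x y = ∑ σ : Fin P.T → J, (∏ t, P.p (σ t) t) * (A σ).profit := by
  classical
  set μ : (Fin P.T → J) → ℝ := fun σ => ∏ t, P.p (σ t) t with hμ
  have hμ0 : ∀ σ, 0 ≤ μ σ := fun σ => Finset.prod_nonneg fun t _ => P.p_nonneg _ t
  have hμ1 : ∑ σ, μ σ = 1 := by
    rw [hμ, ← Fintype.prod_sum fun t j => P.p j t]
    exact Finset.prod_eq_one fun t _ => P.p_sum t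
  have hμt : ∀ j t, ∑ σ, μ σ * (if σ t = j then 1 else 0) = P.p j t := fun j t => by
    have := sum_prod_mul_single (fun t j => P.p j t) P.p_sum t fun j' => if j' = j then 1 else 0
    refine this.trans ?_
    simp
  set z : (Fin P.T → J) → P.E₂ → Fin P.T → ℝ :=
    fun σ e t => if (A σ).pick t = some e then 1 else 0 with hz
  have hz0 : ∀ σ e t, 0 ≤ z σ e t := fun σ e t => by simp only [hz]; split_ifs <;> norm_num
  have hz1 : ∀ σ e t, z σ e t ≤ 1 := fun σ e t => by simp only [hz]; split_ifs <;> norm_num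
  -- One identity for an arbitrary linear functional serves both the resource constraints (`c` a
  -- consumption) and the objective (`c = P.w`).
  have hlin : ∀ c : P.E₁ ⊕ P.E₂ → ℝ,
      ∑ e, (∑ σ, μ σ * (A σ).copies e) * c (Sum.inl e) +
        ∑ e, ∑ t, (∑ σ, μ σ * z σ e t) * c (Sum.inr e) =
      ∑ σ, μ σ * (∑ e, (A σ).copies e * c (Sum.inl e) +
        ∑ t, ((A σ).pick t).elim 0 fun e => c (Sum.inr e)) := by
    intro c
    simp only [option_elim_eq_sum, mul_add, Finset.sum_add_distrib, Finset.mul_sum, Finset.sum_mul]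
    congr 1
    · rw [Finset.sum_comm]
      simp only [mul_assoc]
    · rw [Finset.sum_comm]
      conv_rhs => rw [Finset.sum_comm]
      refine Finset.sum_congr rfl fun t _ => ?_
      rw [Finset.sum_comm]
      simp only [mul_assoc, hz]
  refine ⟨fun e => ∑ σ, μ σ * (A σ).copies e, fun e t => ∑ σ, μ σ * z σ e t,
    ⟨fun j t => ?_, fun k => ?_, fun e => ?_, fun e t => ?_, fun e t => ?_⟩, ?_⟩
  · rw [Finset.sum_comm, ← hμt j t]
    refine Finset.sum_le_sum fun σ _ => ?_
    rw [← Finset.mul_sum]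
    refine mul_le_mul_of_nonneg_left ?_ (hμ0 σ)
    -- At most one edge is taken in round `t`, and it is incident to `σ t`; hence the inner sum is
    -- at most the indicator of `σ t = j`.
    cases ho : (A σ).pick t with
    | none =>
      simp only [hz, ho, reduceCtorEq, if_false, Finset.sum_const_zero]
      split_ifs <;> norm_num
    | some e =>
      have hi := (hA σ).incident t e ho
      simp [hz, ho, hi]
  · rw [hlin fun e => P.a e k]
    calc _ ≤ ∑ σ, μ σ * P.budget k := Finset.sum_le_sum fun σ _ =>
          mul_le_mul_of_nonneg_left ((hA σ).within_budget k) (hμ0 σ)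
      _ = P.budget k := by rw [← Finset.sum_mul, hμ1, one_mul]
  · exact Finset.sum_nonneg fun σ _ => mul_nonneg (hμ0 σ) (Nat.cast_nonneg _)
  · exact Finset.sum_nonneg fun σ _ => mul_nonneg (hμ0 σ) (hz0 σ e t)
  · rw [← hμ1]
    exact Finset.sum_le_sum fun σ _ => mul_le_of_le_one_right (hμ0 σ) (hz1 σ e t)
  · rw [lpValue]
    simp only [mul_comm (P.w _)]
    rw [hlin P.w]
    simp only [Allocation.profit, mul_comm (P.w _)]
    rfl

theorem expectedOpt_le_lpValue {x : P.E₁ → ℝ} {y : P.E₂ → Fin P.T → ℝ} (h : P.IsOptimal x y) :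
    P.expectedOpt ≤ P.lpValue x y := by
  refine le_of_forall_pos_le_add fun δ hδ => ?_
  choose A hA hAδ using fun σ => exists_allocation_near_opt (P := P) σ hδ
  obtain ⟨x', y', hf, hval⟩ := exists_isFeasible_lpValue_eq A hA
  have hμ1 : ∑ σ : Fin P.T → J, ∏ t, P.p (σ t) t = 1 := by
    rw [← Fintype.prod_sum fun t j => P.p j t]
    exact Finset.prod_eq_one fun t _ => P.p_sum t
  calc P.expectedOpt ≤ ∑ σ : Fin P.T → J, (∏ t, P.p (σ t) t) * ((A σ).profit + δ) :=
        Finset.sum_le_sum fun σ _ => mul_le_mul_of_nonneg_left (by linarith [hAδ σ])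
          (Finset.prod_nonneg fun t _ => P.p_nonneg _ t)
    _ = P.lpValue x' y' + δ := by
        simp only [mul_add, Finset.sum_add_distrib]
        rw [← Finset.sum_mul, hμ1, one_mul, hval]
    _ ≤ P.lpValue x y + δ := by linarith [h.maximal x' y' hf]

end opt

/-! ### Budgets against thresholds -/

section bound

variable {x : P.E₁ → ℝ} {y : P.E₂ → Fin P.T → ℝ}

theorem IsFeasible.lpValue_nonneg (h : P.IsFeasible x y) : 0 ≤ P.lpValue x y :=
  add_nonneg (Finset.sum_nonneg fun e _ => mul_nonneg (P.w_pos _).le (h.x_nonneg e))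
    (Finset.sum_nonneg fun e _ => Finset.sum_nonneg fun t _ =>
      mul_nonneg (P.w_pos _).le (h.y_nonneg e t))

theorem expectedProfit_nonneg (h : P.IsFeasible x y) (η α : Set.Ioc (0 : ℝ) 1) :
    0 ≤ P.expectedProfit h η α :=
  Finset.sum_nonneg fun ω _ => mul_nonneg ENNReal.toReal_nonneg (P.samp η x ω).profit_nonneg

/-- Restricting to requested resources matters: a requested non-integral resource forces `ℓ₂ ≥ 1`.
The exponential term then serves only to exclude `B < 2`, and the term `1 / (B - 2)` absorbs the
unit lost in the threshold. -/
theorem budget_le_threshold [Fintype K₁] [Fintype K₂] {ℓ₁ ℓ₂ : ℕ} (hs : P.IsSparse ℓ₁ ℓ₂) {B : ℝ}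
    (hB : B ∈ lowerBounds (Set.range fun k : K₂ => P.budget (Sum.inr k))) (hB2 : B ≠ 2)
    {ε : ℝ} (hε : ε = 2 * max (1 / (B - 2)) (ℓ₂ * Real.exp (-B / 12 + 1 / 6))) (hε1 : ε < 1)
    {e k} (ha : 0 < P.a e k) :
    0 < P.threshold k ∧ P.budget k ≤ (1 + ε) * P.threshold k := by
  have hexp : ℓ₂ * Real.exp (-B / 12 + 1 / 6) ≤ ε / 2 := by
    rw [hε]
    linarith [le_max_right (1 / (B - 2)) (ℓ₂ * Real.exp (-B / 12 + 1 / 6))]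
  have hinv : 1 / (B - 2) ≤ ε / 2 := by
    rw [hε]
    linarith [le_max_left (1 / (B - 2)) (ℓ₂ * Real.exp (-B / 12 + 1 / 6))]
  have hε0 : 0 ≤ ε := by
    have : (0 : ℝ) ≤ ℓ₂ * Real.exp (-B / 12 + 1 / 6) := by positivity
    linarith
  rcases k with k | k
  · have := P.budget_pos (Sum.inl k)
    simp only [threshold, Sum.elim_inl]
    exact ⟨this, by nlinarith⟩
  · have hℓ₂ : (1 : ℝ) ≤ ℓ₂ := by
      have h1 := (hs e).2
      have h2 : 0 < (Finset.univ.filter fun k : K₂ => 0 < P.a e (Sum.inr k)).card :=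
        Finset.card_pos.2 ⟨k, Finset.mem_filter.2 ⟨Finset.mem_univ k, ha⟩⟩
      exact_mod_cast h2.trans_le h1
    have hBk : B ≤ P.budget (Sum.inr k) := hB ⟨k, rfl⟩
    have hB' : 2 < B := by
      -- If `B < 2`, the exponent is positive, so `ε ≥ 2 * ℓ₂ ≥ 2`, against `ε < 1`.
      refine lt_of_le_of_ne (not_lt.1 fun hlt => ?_) hB2.symm
      have h1 : 1 ≤ Real.exp (-B / 12 + 1 / 6) := Real.one_le_exp (by linarith)
      nlinarith
    rw [div_le_iff₀ (by linarith)] at hinv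
    simp only [threshold, Sum.elim_inr]
    -- The second claim amounts to `1 ≤ ε * (budget - 1)`, which follows from `2 ≤ ε * (B - 2)` and
    -- `B ≤ budget`.
    exact ⟨by linarith, by nlinarith⟩

end bound

end TSRA

end

/-! ### Assembly of the main theorem -/

theorem theorem2 {I H J K₁ K₂ : Type*} [Fintype J] [Fintype K₁] [Fintype K₂]
    (P : TSRA I H J K₁ K₂)
    (ℓ₁ ℓ₂ : ℕ) (hsparse : P.IsSparse ℓ₁ ℓ₂) (hℓ : 1 ≤ ℓ₁ + ℓ₂)
    (B : ℝ) (hB : IsLeast (Set.range fun k : K₂ => P.budget (Sum.inr k)) B) (hB2 : B ≠ 2)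
    (ε : ℝ) (hε : ε = 2 * max (1 / (B - 2)) (ℓ₂ * Real.exp (-B / 12 + 1 / 6)))
    (x : P.E₁ → ℝ) (y : P.E₂ → Fin P.T → ℝ) (hopt : P.IsOptimal x y)
    (η α : Set.Ioc (0 : ℝ) 1) (hη : η = halfInv (ℓ₁ + ℓ₂) hℓ) (hα : α = halfInv (ℓ₁ + ℓ₂) hℓ) :
    (∀ ω ∈ (TSRA.coinLaw hopt.feasible η α).support,
      (P.samp η x ω).IsAdmissible (P.arrivals ω)) ∧
    (1 - ε) / (4 * (ℓ₁ + ℓ₂ : ℝ)) * P.lpValue x y ≤ P.expectedProfit hopt.feasible η α ∧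
    (1 - ε) / (4 * (ℓ₁ + ℓ₂ : ℝ)) * P.expectedOpt ≤ P.expectedProfit hopt.feasible η α := by
  refine ⟨fun ω hω => TSRA.samp_isAdmissible hopt.feasible η α hω, ?_⟩
  have hL : (1 : ℝ) ≤ ℓ₁ + ℓ₂ := by exact_mod_cast hℓ
  have hL0 : (0 : ℝ) < 4 * (ℓ₁ + ℓ₂ : ℝ) := by linarith
  -- For `ε ≥ 1` the guaranteed factor is nonpositive while the profit is nonnegative.
  rcases le_or_gt 1 ε with hε1 | hε1
  · have hc : (1 - ε) / (4 * (ℓ₁ + ℓ₂ : ℝ)) ≤ 0 :=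
      div_nonpos_of_nonpos_of_nonneg (by linarith) hL0.le
    have hp := TSRA.expectedProfit_nonneg hopt.feasible η α
    exact ⟨(mul_nonpos_of_nonpos_of_nonneg hc hopt.feasible.lpValue_nonneg).trans hp,
      (mul_nonpos_of_nonpos_of_nonneg hc TSRA.expectedOpt_nonneg).trans hp⟩
  have hε0 : 0 ≤ ε := by
    rw [hε]
    -- The exponential term gives the sign, since `1 / (B - 2)` may be negative.
    exact mul_nonneg zero_le_two (le_max_of_le_right (by positivity))
  have hmain : (1 - ε) / (4 * (ℓ₁ + ℓ₂ : ℝ)) * P.lpValue x y ≤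
      P.expectedProfit hopt.feasible η α := by
    obtain rfl : η = α := hη.trans hα.symm
    have hθ : (η : ℝ) = 1 / (2 * (ℓ₁ + ℓ₂)) := by rw [hη, halfInv]; push_cast; rfl
    refine le_trans (le_of_eq ?_) (TSRA.le_expectedProfit hopt.feasible η hsparse hε0 ?_
      fun e k ha => TSRA.budget_le_threshold hsparse hB.2 hB2 hε hε1 ha)
    · rw [hθ]
      have : (ℓ₁ + ℓ₂ : ℝ) ≠ 0 := by linarith
      congr 1
      field_simp
      ring
    · rw [hθ, one_div_mul_eq_div, div_lt_one (by linarith)]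
      linarith
  exact ⟨hmain, (mul_le_mul_of_nonneg_left (TSRA.expectedOpt_le_lpValue hopt)
    (div_nonneg (by linarith) hL0.le)).trans hmain⟩
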